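/- Let $\mathcal H$ be a separable, infinite-dimensional real Hilbert space, and give $\mathcal H^L$ the inner product $\sum_i\langle x_i,y_i\rangle$. Write $x\otimes y=\langle x,\cdot\rangle y$, $\mathscr C_{X,Y}=\mathbb E[(X-\mathbb EX)\otimes(Y-\mathbb EY)]$, $\|\cdot\|_{\mathcal S}$ and $\langle\cdot,\cdot\rangle_{\mathcal S}$ for the Hilbert–Schmidt (H-S) norm and inner product. All asymptotics are for the sample size $N\to\infty$; $Y_N=\mathrm O_{\mathbb P}(a_N)$ means that for every $\delta>0$ there is $M$ with $\mathbb P(Y_N>Ma_N)\le\delta$ for all large $N$. Let $p\ge 1$ and let $(X_k)_{k\in\mathbb Z}$ be a centered, strictly stationary $\mathcal H$-valued fAR$(p)$ process with $\mathbb E\|X_k\|^2<\infty$, i.e. $$X_k=\varepsilon_k+\sum_{i=1}^p\alpha_i(X_{k-i})\quad\text{a.s.},\qquad k\in\mathbb Z,$$ with bounded linear operators $\alpha_i$ on $\mathcal H$, $\alpha_p\ne0$, where $(\varepsilon_k)$ is a strictly stationary, ergodic white noise (centered, weakly stationary, $\mathbb E\|\varepsilon_k\|^2>0$, $\mathscr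 C_{\varepsilon_k,\varepsilon_l}=0$ for $k\neq l$) with $\mathbb E\|\varepsilon_k\|^4<\infty$ and injective covariance operator $\mathscr C_{\varepsilon_0,\varepsilon_0}$, and $\varepsilon_k$ is uncorrelated with the past of the process: $\mathscr C_{X_{k-j},\varepsilon_k}=0$ for all $k\in\mathbb Z$, $j\ge1$. Put $X^{[p]}_k=(X_k,\dots,X_{k-p+1})^\top$, $\mathscr C=\mathscr C_{X^{[p]}_0,X^{[p]}_0}$, $\mathscr D=\mathscr C_{X_0^{[p]},X_1}$, and, from the sample $X_1,\dots,X_N$, $$\hat{\mathscr C}=\frac1{N-p+1}\sum_{k=p}^NX^{[p]}_k\otimes X^{[p]}_k,\qquad \hat{\mathscr D}=\frac1{N-p}\sum_{k=p}^{N-1}X^{[p]}_k\otimes X_{k+1}.$$ Let $(\lambda_j,c_j)_{j\ge1}$, $(\hat\lambda_j,\hat c_j)_{j\ge1}$, $(\mu_j,d_j)_{j\ge1}$ be the eigenvalue/eigenfunction pairs of $\mathscr C$, $\hat{\mathscr C}$ and $\mathscr C_{X_0,X_0}$, with decreasing eigenvalues and eigenfunctions forming complete orthonormal systems, and put $\Lambda_k=\max_{1\le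 j\le k}(\lambda_j-\lambda_{j+1})^{-1}$. Let $A_p=(\alpha_1\cdots\alpha_p)\colon\mathcal H^p\to\mathcal H$. Suppose: 1. $\|\hat{\mathscr C}-\mathscr C\|_{\mathcal S}=\mathrm O_{\mathbb P}(p^{3/2}N^{-1/2})$ and $\|\hat{\mathscr D}-\mathscr D\|_{\mathcal S}=\mathrm O_{\mathbb P}(pN^{-1/2})$; 2. $\lambda_j\ne\lambda_{j+1}$ for all $j$; 3. every $\alpha_i$ is an H-S operator, and for some $\beta>0$, $\sum_{i,j\ge1}\langle A_p,c_i\otimes d_j\rangle_{\mathcal S}^2\,(1+i^{2\beta}+j^{2\beta})<\infty$; 4. $K=K_N\in\mathbb N$ and $\theta_N>0$ satisfy $K_N\to\infty$, $\theta_N\to0$, $\theta_N=\mathrm o(\lambda_K)$, $K^{1+\beta}\lambda_K^{-1}\Lambda_Kp^2=\mathrm O(N^{1/2})$ and $\theta_N=\mathrm o(K\Lambda_Kp^2N^{-1/2})$. Let $\hat A_p=\hat{\mathscr D}\,(\hat{\mathscr C}+\theta_N\mathbb I)^{-1}\hat\Pi_K$, where $\hat\Pi_K$ is the orthogonal projection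 onto $\mathrm{span}\{\hat c_1,\dots,\hat c_K\}$, and let $\hat\alpha_1,\dots,\hat\alpha_p$ be its components, $\hat A_p=(\hat\alpha_1\cdots\hat\alpha_p)$. Then $$\|\hat\alpha_i-\alpha_i\|_{\mathcal S}=\mathrm O_{\mathbb P}(K^{-\beta}),\qquad i=1,\dots,p.$$ -/

import Mathlib

open MeasureTheory ProbabilityTheory Filter Topology Asymptotics
open scoped ENNReal

namespace FAR

noncomputable section

/-! ### Hilbert-Schmidt operators -/

section HilbertSchmidt

variable {E F : Type*} [NormedAddCommGroup E] [InnerProductSpace ℝ E]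
  [NormedAddCommGroup F] [InnerProductSpace ℝ F]

/-- The tensorial product `x ⊗ y = ⟨x, ·⟩ y`. -/
def tensor (x : E) (y : F) : E →L[ℝ] F := InnerProductSpace.rankOne ℝ y x

theorem tensor_apply (x : E) (y : F) (z : E) : tensor x y z = (inner ℝ x z : ℝ) • y := by
  simp [tensor, InnerProductSpace.rankOne_apply]

/-- The index set of a fixed complete orthonormal system of `E`. -/
def basisIndex (E : Type*) [NormedAddCommGroup E] [InnerProductSpace ℝ E] [CompleteSpace E] :
    Set E := (exists_hilbertBasis ℝ E).choose

/-- A fixed complete orthonormal system of `E`. -/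
def stdBasis (E : Type*) [NormedAddCommGroup E] [InnerProductSpace ℝ E] [CompleteSpace E] :
    HilbertBasis (basisIndex E) ℝ E := (exists_hilbertBasis ℝ E).choose_spec.choose

/-- The squared Hilbert-Schmidt norm `∑ᵢ ‖T eᵢ‖²`, with value `∞` if `T` is not Hilbert-Schmidt.
It does not depend on the complete orthonormal system, see `hsNormSq_eq`. -/
def hsNormSq [CompleteSpace E] (T : E →L[ℝ] F) : ℝ≥0∞ :=
  ∑' i, ENNReal.ofReal (‖T (stdBasis E i)‖ ^ 2)

/-- The Hilbert-Schmidt norm, with value `∞` if the operator is not Hilbert-Schmidt. -/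
def hsNorm [CompleteSpace E] (T : E →L[ℝ] F) : ℝ≥0∞ := hsNormSq T ^ (1 / 2 : ℝ)

/-- `T` is a Hilbert-Schmidt operator. -/
def IsHilbertSchmidt [CompleteSpace E] (T : E →L[ℝ] F) : Prop := hsNorm T < ∞

/-- The Hilbert-Schmidt inner product `∑ᵢ ⟨T eᵢ, S eᵢ⟩`. -/
def hsInner [CompleteSpace E] (T S : E →L[ℝ] F) : ℝ :=
  ∑' i, (inner ℝ (T (stdBasis E i)) (S (stdBasis E i)) : ℝ)

theorem ofReal_norm_sq_eq_tsum {ι : Type*} (b : HilbertBasis ι ℝ E) (x : E) :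
    ENNReal.ofReal (‖x‖ ^ 2) = ∑' i, ENNReal.ofReal ((inner ℝ x (b i) : ℝ) ^ 2) := by
  have h := b.hasSum_inner_mul_inner x x
  have h' : HasSum (fun i => (inner ℝ x (b i) : ℝ) ^ 2) (‖x‖ ^ 2) := by
    rw [← real_inner_self_eq_norm_sq]
    refine h.congr_fun fun i => ?_
    rw [real_inner_comm (b i) x, sq, real_inner_comm]
  rw [← h'.tsum_eq, ENNReal.ofReal_tsum_of_nonneg (fun i => sq_nonneg _) h'.summable]

theorem tsum_norm_sq_eq_adjoint [CompleteSpace E] [CompleteSpace F] {ι κ : Type*}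
    (b : HilbertBasis ι ℝ E) (f : HilbertBasis κ ℝ F) (T : E →L[ℝ] F) :
    ∑' i, ENNReal.ofReal (‖T (b i)‖ ^ 2)
      = ∑' j, ENNReal.ofReal (‖ContinuousLinearMap.adjoint T (f j)‖ ^ 2) := by
  simp_rw [ofReal_norm_sq_eq_tsum f, ofReal_norm_sq_eq_tsum b]
  rw [ENNReal.tsum_comm]
  simp_rw [ContinuousLinearMap.adjoint_inner_left, real_inner_comm]

theorem hsNormSq_eq [CompleteSpace E] [CompleteSpace F] {ι : Type*} (b : HilbertBasis ι ℝ E)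
    (T : E →L[ℝ] F) : hsNormSq T = ∑' i, ENNReal.ofReal (‖T (b i)‖ ^ 2) := by
  rw [hsNormSq, tsum_norm_sq_eq_adjoint _ (stdBasis F) T, tsum_norm_sq_eq_adjoint b (stdBasis F) T]

theorem hsInner_tensor [CompleteSpace E] [CompleteSpace F] (T : E →L[ℝ] F) (x : E) (y : F) :
    hsInner T (tensor x y) = inner ℝ (T x) y := by
  have h := (stdBasis E).tsum_inner_mul_inner x (ContinuousLinearMap.adjoint T y)
  rw [ContinuousLinearMap.adjoint_inner_right] at h
  rw [← h, hsInner]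
  refine tsum_congr fun i => ?_
  rw [tensor_apply, inner_smul_right, ContinuousLinearMap.adjoint_inner_right]

/-- `(ev j, ef j)`, `j = 0, 1, …`, is the sequence of eigenvalue/eigenfunction pairs of `T`: the
eigenvalues are in decreasing order and the eigenfunctions form a complete orthonormal system. -/
def IsEigenSystem (T : E →L[ℝ] E) (ev : ℕ → ℝ) (ef : HilbertBasis ℕ ℝ E) : Prop :=
  Antitone ev ∧ ∀ j, T (ef j) = ev j • ef j

/-- The orthogonal projection onto the span of the first `K` members of `ef`. -/
def projFirst (ef : HilbertBasis ℕ ℝ E) (K : ℕ) : E →L[ℝ] E :=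
  haveI : FiniteDimensional ℝ (Submodule.span ℝ (Set.range fun j : Fin K => ef j)) :=
    FiniteDimensional.span_of_finite ℝ (Set.finite_range _)
  (Submodule.span ℝ (Set.range fun j : Fin K => ef j)).starProjection

/-- `max_{1 ≤ j ≤ K} (λ_j - λ_{j+1})⁻¹`, where `λ_j = ev (j - 1)`. -/
def invGap (ev : ℕ → ℝ) (K : ℕ) : ℝ := ⨆ j : Fin K, (ev j - ev (j + 1))⁻¹

/-- The Sobolev type sum `∑ᵢ ∑ⱼ ⟨T, cᵢ ⊗ dⱼ⟩² (1 + i^(2β) + j^(2β))` over `i, j ≥ 1`, where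
`cᵢ = c (i - 1)` and `dⱼ = d (j - 1)`. -/
def sobolevSum [CompleteSpace E] (T : E →L[ℝ] F) (c : HilbertBasis ℕ ℝ E)
    (d : HilbertBasis ℕ ℝ F) (β : ℝ) : ℝ≥0∞ :=
  ∑' i : ℕ, ∑' j : ℕ, ENNReal.ofReal (hsInner T (tensor (c i) (d j)) ^ 2 *
    (1 + ((i : ℝ) + 1) ^ (2 * β) + ((j : ℝ) + 1) ^ (2 * β)))

end HilbertSchmidt

/-! ### Processes -/

section Processes

variable {Ω : Type*} [MeasurableSpace Ω]
  {E F : Type*} [NormedAddCommGroup E] [InnerProductSpace ℝ E]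
  [NormedAddCommGroup F] [InnerProductSpace ℝ F]

/-- `Y_N = O_P(a_N)` as `N → ∞`. -/
def IsBigOInProb (μ : Measure Ω) (Y : ℕ → Ω → ℝ≥0∞) (a : ℕ → ℝ) : Prop :=
  ∀ δ : ℝ, 0 < δ → ∃ M : ℝ, 0 < M ∧
    ∀ᶠ N in atTop, μ {ω | ENNReal.ofReal (M * a N) < Y N ω} ≤ ENNReal.ofReal δ

/-- The cross-covariance operator `E[(X - E X) ⊗ (Y - E Y)]`. -/
def crossCov (μ : Measure Ω) (X : Ω → E) (Y : Ω → F) : E →L[ℝ] F :=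
  ∫ ω, tensor (X ω - ∫ ω', X ω' ∂μ) (Y ω - ∫ ω', Y ω' ∂μ) ∂μ

/-- The process is centered. -/
def IsCentered (μ : Measure Ω) (X : ℤ → Ω → E) : Prop :=
  ∀ k, Integrable (X k) μ ∧ ∫ ω, X k ω ∂μ = 0

/-- Strict stationarity. -/
def IsStationary [MeasurableSpace E] (μ : Measure Ω) (X : ℤ → Ω → E) : Prop :=
  ∀ (n : ℕ) (t : Fin n → ℤ) (h : ℤ),
    IdentDistrib (fun ω i => X (t i) ω) (fun ω i => X (t i + h) ω) μ μ

/-- Ergodicity: the left shift is ergodic for the law of the process on the path space. -/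
def IsErgodic [MeasurableSpace E] (μ : Measure Ω) (X : ℤ → Ω → E) : Prop :=
  Ergodic (fun (x : ℤ → E) k => x (k + 1)) (μ.map fun ω k => X k ω)

/-- Weak stationarity. -/
def IsWeaklyStationary (μ : Measure Ω) (X : ℤ → Ω → E) : Prop :=
  (∀ k, MemLp (X k) 2 μ) ∧ (∃ m : E, ∀ k, ∫ ω, X k ω ∂μ = m) ∧
    ∀ h k l : ℤ, crossCov μ (X k) (X l) = crossCov μ (X (k + h)) (X (l + h))

/-- White noise. -/
def IsWhiteNoise (μ : Measure Ω) (X : ℤ → Ω → E) : Prop :=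
  IsCentered μ X ∧ IsWeaklyStationary μ X ∧ (∀ k, 0 < ∫ ω, ‖X k ω‖ ^ 2 ∂μ) ∧
    ∀ k l, k ≠ l → crossCov μ (X k) (X l) = 0

/-- `X` is the functional autoregressive process of order `p` with white noise `ε` and operators
`α_1, …, α_p`, where `α_i` is written `α (i - 1)`. -/
structure IsFAR (μ : Measure Ω) (p : ℕ) (α : Fin p → E →L[ℝ] E) (X ε : ℤ → Ω → E) : Prop where
  order_pos : 1 ≤ p
  centered : IsCentered μ X
  whiteNoise : IsWhiteNoise μ ε
  last_ne_zero : ∀ i : Fin p, (i : ℕ) + 1 = p → α i ≠ 0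
  eqn : ∀ k : ℤ, ∀ᵐ ω ∂μ, X k ω = ε k ω + ∑ i : Fin p, α i (X (k - ((i : ℕ) + 1)) ω)

end Processes

/-! ### The estimators -/

section Estimators

variable {Ω : Type*} {H : Type*} [NormedAddCommGroup H] [InnerProductSpace ℝ H]

/-- The Cartesian power `H^L` as a Hilbert space. -/
abbrev Pow (H : Type*) (L : ℕ) : Type _ := PiLp 2 (fun _ : Fin L => H)

/-- The operator `(A_1 ⋯ A_L)` from `H^L` to `H`. -/
def rowOp {L : ℕ} (A : Fin L → H →L[ℝ] H) : Pow H L →L[ℝ] H :=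
  ∑ i, A i ∘L PiLp.proj 2 (fun _ : Fin L => H) i

/-- The `i`-th component of an operator from `H^L` to `H`. -/
def component {L : ℕ} (A : Pow H L →L[ℝ] H) (i : Fin L) : H →L[ℝ] H :=
  A ∘L (PiLp.continuousLinearEquiv 2 ℝ (fun _ : Fin L => H)).symm.toContinuousLinearMap ∘L
    ContinuousLinearMap.single ℝ (fun _ : Fin L => H) i

theorem component_rowOp {L : ℕ} (A : Fin L → H →L[ℝ] H) (i : Fin L) :
    component (rowOp A) i = A i := by
  ext x
  simp only [component, rowOp, ContinuousLinearMap.comp_apply, sum_apply]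
  rw [Finset.sum_eq_single i]
  · simp
  · intro j _ hj
    simp [hj]
  · simp

/-- `X^{[L]}_k = (X_k, X_{k-1}, …, X_{k-L+1})`. -/
def lagVec (X : ℤ → Ω → H) (L : ℕ) (k : ℤ) (ω : Ω) : Pow H L :=
  WithLp.toLp 2 fun i : Fin L => X (k - (i : ℕ)) ω

/-- The empirical covariance operator of `X^{[L]}` from the sample `X_1, …, X_N`. -/
def empCov (X : ℤ → Ω → H) (L N : ℕ) (ω : Ω) : Pow H L →L[ℝ] Pow H L :=
  ((N : ℝ) - L + 1)⁻¹ • ∑ k ∈ Finset.Icc L N, tensor (lagVec X L k ω) (lagVec X L k ω)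

/-- The empirical lag-1-cross-covariance operator of `X^{[L]}` and `X` from the sample
`X_1, …, X_N`. -/
def empCross (X : ℤ → Ω → H) (L N : ℕ) (ω : Ω) : Pow H L →L[ℝ] H :=
  ((N : ℝ) - L)⁻¹ • ∑ k ∈ Finset.Ico L N, tensor (lagVec X L k ω) (X (k + 1) ω)

/-- The Tychonoff-regularized estimator `D̂ (Ĉ + θ I)⁻¹ Π`, where `Π` is the projection onto the
span of the first `K` members of `ef` (eigenfunctions of `Ĉ`). -/
def estimator (X : ℤ → Ω → H) (L N K : ℕ) (θ : ℝ) (ω : Ω) (ef : HilbertBasis ℕ ℝ (Pow H L)) :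
    Pow H L →L[ℝ] H :=
  empCross X L N ω ∘L
    Ring.inverse (empCov X L N ω + θ • ContinuousLinearMap.id ℝ (Pow H L)) ∘L projFirst ef K

end Estimators

end

end FAR

/-! The argument is pathwise and deterministic; probability enters only through a union bound. Write
A for `rowOp α`, C and D for the population operators, Π_K and Π̂_K for the projections onto the
first K eigenfunctions of C and Ĉ. Since the innovation is uncorrelated with the past, the
Yule-Walker equation D = AC holds.

Evaluate Â − A on the eigenbasis ĉ_j of Ĉ and sum squares. For j ≤ K, (Â − A)ĉ_j = (λ̂_j + θ)⁻¹[(D̂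
− AC)ĉ_j − A(Ĉ − C)ĉ_j − θAĉ_j]. For j > K, the estimator vanishes on ĉ_j, leaving −Aĉ_j = −(A −
AΠ_K)ĉ_j − AΠ_Kĉ_j. Its first part is the tail of A, of H-S size O(K^(-β)) by the Sobolev condition;
the second is controlled by (Ĉ − C)ĉ_j divided by the spectral gap at K (`mul_norm_projFirst_le`).
Summation yields H-S norms (`hsNormSq_regularized_sub_le`). Empirical eigenfunctions are never
matched one by one with the population ones, so only the gap λ_K − λ_{K+1} matters and no signs need
fixing.

Weyl's inequality replaces λ̂_j by λ_j once the error b of the covariance estimates is below λ_K/2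
and half the gap. The tuning conditions give this, and also make b/λ_K, θ/λ_K and b/(λ_K − λ_{K+1})
of order K^(-β) (`exists_eventually_radius_le`). -/

namespace FAR

/-! ### Hilbert-Schmidt norms -/

section Operators

set_option linter.unusedSectionVars false

variable {E F G : Type*} [NormedAddCommGroup E] [InnerProductSpace ℝ E] [CompleteSpace E]
  [NormedAddCommGroup F] [InnerProductSpace ℝ F] [CompleteSpace F]
  [NormedAddCommGroup G] [InnerProductSpace ℝ G] [CompleteSpace G]

theorem hsNormSq_adjoint (T : E →L[ℝ] F) :
    hsNormSq (ContinuousLinearMap.adjoint T) = hsNormSq T := by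
  rw [hsNormSq, ← tsum_norm_sq_eq_adjoint (stdBasis E) (stdBasis F) T, hsNormSq]

theorem hsNormSq_comp_le (S : F →L[ℝ] G) (T : E →L[ℝ] F) :
    hsNormSq (S ∘L T) ≤ ENNReal.ofReal (‖S‖ ^ 2) * hsNormSq T := by
  rw [hsNormSq, hsNormSq, ← ENNReal.tsum_mul_left]
  refine ENNReal.tsum_le_tsum fun i => ?_
  rw [← ENNReal.ofReal_mul (by positivity), ← mul_pow]
  gcongr
  exact S.le_opNorm _

theorem hsNormSq_comp_le' (S : F →L[ℝ] G) (T : E →L[ℝ] F) :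
    hsNormSq (S ∘L T) ≤ ENNReal.ofReal (‖T‖ ^ 2) * hsNormSq S := by
  rw [← hsNormSq_adjoint, ContinuousLinearMap.adjoint_comp, ← hsNormSq_adjoint S]
  refine (hsNormSq_comp_le _ _).trans_eq ?_
  rw [LinearIsometryEquiv.norm_map]

/-- Expand T x in a basis of F, move T onto the basis vectors as its adjoint, and apply
Cauchy-Schwarz to each coordinate. This gives the bound of the operator norm by the H-S norm. -/
theorem ofReal_norm_apply_sq_le_hsNormSq (T : E →L[ℝ] F) (x : E) :
    ENNReal.ofReal (‖T x‖ ^ 2) ≤ ENNReal.ofReal (‖x‖ ^ 2) * hsNormSq T := by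
  rw [← hsNormSq_adjoint, hsNormSq, ← ENNReal.tsum_mul_left,
    ofReal_norm_sq_eq_tsum (stdBasis F)]
  refine ENNReal.tsum_le_tsum fun i => ?_
  rw [← ENNReal.ofReal_mul (by positivity), ← mul_pow, ← ContinuousLinearMap.adjoint_inner_right,
    ← sq_abs (inner ℝ x _)]
  gcongr
  exact abs_real_inner_le_norm _ _

theorem norm_le_of_hsNormSq_le {T : E →L[ℝ] F} {r : ℝ} (hr : 0 ≤ r)
    (h : hsNormSq T ≤ ENNReal.ofReal (r ^ 2)) : ‖T‖ ≤ r := by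
  refine T.opNorm_le_bound hr fun x => ?_
  have h1 := (ofReal_norm_apply_sq_le_hsNormSq T x).trans (mul_le_mul_right h _)
  rw [← ENNReal.ofReal_mul (by positivity), ENNReal.ofReal_le_ofReal_iff (by positivity),
    ← mul_pow] at h1
  rw [mul_comm]
  exact (le_abs_self _).trans (abs_le_of_sq_le_sq h1 (by positivity))

theorem hsNorm_le_ofReal_iff {T : E →L[ℝ] F} {r : ℝ} (hr : 0 ≤ r) :
    hsNorm T ≤ ENNReal.ofReal r ↔ hsNormSq T ≤ ENNReal.ofReal (r ^ 2) := by
  rw [hsNorm, ENNReal.ofReal_pow hr, one_div, ENNReal.rpow_inv_le_iff (by norm_num)]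
  norm_num

/-! ### Eigensystems and perturbation of eigenvalues -/

namespace IsEigenSystem

variable {T T' : E →L[ℝ] E} {ev ev' : ℕ → ℝ} {ef ef' : HilbertBasis ℕ ℝ E}

/-- Symmetry of T is not part of `IsEigenSystem`; it is recovered here by applying the continuous T
termwise to the eigenfunction expansion of x. -/
theorem inner_apply (h : IsEigenSystem T ev ef) (i : ℕ) (x : E) :
    (inner ℝ (ef i) (T x) : ℝ) = ev i * inner ℝ (ef i) x := by
  have h1 := ((ef.hasSum_repr x).mapL T).mapL (innerSL ℝ (ef i))
  have h2 := hasSum_single (f := fun j => innerSL ℝ (ef i) (T (ef.repr x j • ef j))) i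
    fun j hj => by
      simp [h.2 j, ef.orthonormal.2 hj.symm]
  have h3 := h1.unique h2
  simpa [h.2 i, inner_smul_right, ef.repr_apply_apply, real_inner_self_eq_norm_sq,
    ef.orthonormal.1 i, mul_comm] using h3

theorem hasSum_inner_self (h : IsEigenSystem T ev ef) (x : E) :
    HasSum (fun i => ev i * (inner ℝ (ef i) x : ℝ) ^ 2) (inner ℝ x (T x)) := by
  refine (ef.hasSum_inner_mul_inner x (T x)).congr_fun fun i => ?_
  rw [h.inner_apply, real_inner_comm (ef i) x]
  ring

theorem hasSum_mul_norm_sq (ef : HilbertBasis ℕ ℝ E) (a : ℝ) (x : E) :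
    HasSum (fun i => a * (inner ℝ (ef i) x : ℝ) ^ 2) (a * ‖x‖ ^ 2) := by
  have := (ef.hasSum_inner_mul_inner x x).mul_left a
  rw [real_inner_self_eq_norm_sq] at this
  refine this.congr_fun fun i => ?_
  rw [real_inner_comm (ef i) x, sq]

theorem mul_norm_sq_le_inner (h : IsEigenSystem T ev ef) (j : ℕ) {x : E}
    (hx : ∀ k, j < k → (inner ℝ (ef k) x : ℝ) = 0) : ev j * ‖x‖ ^ 2 ≤ inner ℝ x (T x) := by
  refine hasSum_le (fun i => ?_) (hasSum_mul_norm_sq ef (ev j) x) (h.hasSum_inner_self x)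
  rcases le_or_gt i j with hi | hi
  · exact mul_le_mul_of_nonneg_right (h.1 hi) (sq_nonneg _)
  · simp [hx i hi]

theorem inner_le_mul_norm_sq (h : IsEigenSystem T ev ef) (j : ℕ) {x : E}
    (hx : ∀ k, k < j → (inner ℝ (ef k) x : ℝ) = 0) : inner ℝ x (T x) ≤ ev j * ‖x‖ ^ 2 := by
  refine hasSum_le (fun i => ?_) (h.hasSum_inner_self x) (hasSum_mul_norm_sq ef (ev j) x)
  rcases lt_or_ge i j with hi | hi
  · simp [hx i hi]
  · exact mul_le_mul_of_nonneg_right (h.1 hi) (sq_nonneg _)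

/-- Weyl's inequality. -/
theorem eigenvalue_le_add_norm (h : IsEigenSystem T ev ef) (h' : IsEigenSystem T' ev' ef')
    (j : ℕ) : ev' j ≤ ev j + ‖T' - T‖ := by
  -- Dimension count: j linear conditions on j + 1 coefficients leave a nonzero v in the span of the
  -- first j + 1 vectors of `ef'`, orthogonal to the first j vectors of `ef`. The quadratic forms at
  -- v then compare the two eigenvalues.
  let f : (Fin (j + 1) → ℝ) →ₗ[ℝ] (Fin j → ℝ) :=
    LinearMap.pi (fun i : Fin j => (innerₛₗ ℝ (ef i))) ∘ₗ
      Fintype.linearCombination ℝ (fun k : Fin (j + 1) => ef' k)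
  obtain ⟨a, ha, ha0⟩ := (Submodule.ne_bot_iff _).1
    (LinearMap.ker_ne_bot_of_finrank_lt (f := f) (by simp))
  set v : E := ∑ k : Fin (j + 1), a k • ef' k with hv
  have hfv : ∀ i, i < j → (inner ℝ (ef i) v : ℝ) = 0 := fun i hi => by
    have := congrFun (LinearMap.mem_ker.1 ha) ⟨i, hi⟩
    simpa [f, Fintype.linearCombination_apply, hv, inner_sum, inner_smul_right] using this
  have hv' : ∀ k, j < k → (inner ℝ (ef' k) v : ℝ) = 0 := fun k hk => by
    rw [hv, inner_sum]
    refine Finset.sum_eq_zero fun i _ => ?_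
    rw [inner_smul_right, ef'.orthonormal.2 (by omega), mul_zero]
  have hv0 : v ≠ 0 := fun h0 => ha0 <| by
    have hl : LinearIndependent ℝ fun k : Fin (j + 1) => ef' k :=
      ef'.orthonormal.linearIndependent.comp (fun k : Fin (j + 1) => (k : ℕ)) Fin.val_injective
    exact funext (Fintype.linearIndependent_iff.1 hl a h0)
  have hpos : 0 < ‖v‖ ^ 2 := by positivity
  have h1 := h'.mul_norm_sq_le_inner j hv'
  have h2 := h.inner_le_mul_norm_sq j hfv
  have h3 : (inner ℝ v (T' v) : ℝ) - inner ℝ v (T v) ≤ ‖T' - T‖ * ‖v‖ ^ 2 := by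
    rw [← inner_sub_right, ← sub_apply]
    calc _ ≤ ‖v‖ * ‖(T' - T) v‖ := real_inner_le_norm _ _
      _ ≤ ‖v‖ * (‖T' - T‖ * ‖v‖) := by gcongr; exact (T' - T).le_opNorm v
      _ = _ := by ring
  refine le_of_mul_le_mul_right ?_ hpos
  linarith

theorem eigenvalue_nonneg (h : IsEigenSystem T ev ef) (hT : ∀ x, 0 ≤ (inner ℝ x (T x) : ℝ))
    (j : ℕ) : 0 ≤ ev j := by
  have := hT (ef j)
  rwa [h.2 j, inner_smul_right, real_inner_self_eq_norm_sq, ef.orthonormal.1 j, one_pow,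
    mul_one] at this

theorem norm_sub_le (h : IsEigenSystem T ev ef) (h' : IsEigenSystem T' ev' ef') (j : ℕ) :
    |ev' j - ev j| ≤ ‖T' - T‖ := by
  rw [abs_sub_le_iff]
  have h1 := h.eigenvalue_le_add_norm h' j
  have h2 := h'.eigenvalue_le_add_norm h j
  rw [norm_sub_rev] at h2
  constructor <;> linarith

end IsEigenSystem

/-! ### Spectral projections -/

theorem projFirst_apply_of_lt (ef : HilbertBasis ℕ ℝ E) {K j : ℕ} (hj : j < K) :
    projFirst ef K (ef j) = ef j := by
  have : FiniteDimensional ℝ (Submodule.span ℝ (Set.range fun j : Fin K => ef j)) :=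
    FiniteDimensional.span_of_finite ℝ (Set.finite_range _)
  exact Submodule.starProjection_eq_self_iff.2 (Submodule.subset_span ⟨⟨j, hj⟩, rfl⟩)

theorem projFirst_apply_of_le (ef : HilbertBasis ℕ ℝ E) {K j : ℕ} (hj : K ≤ j) :
    projFirst ef K (ef j) = 0 := by
  have : FiniteDimensional ℝ (Submodule.span ℝ (Set.range fun j : Fin K => ef j)) :=
    FiniteDimensional.span_of_finite ℝ (Set.finite_range _)
  refine (Submodule.starProjection_apply_eq_zero_iff _).2 ?_
  rw [Submodule.mem_orthogonal]
  intro u hu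
  induction hu using Submodule.span_induction with
  | mem x hx =>
    obtain ⟨k, rfl⟩ := hx
    exact ef.orthonormal.2 (by have := k.2; omega)
  | zero => simp
  | add x y _ _ hx hy => rw [inner_add_left, hx, hy, add_zero]
  | smul a x _ hx => rw [inner_smul_left, hx, mul_zero]

theorem inner_projFirst (ef : HilbertBasis ℕ ℝ E) (K j : ℕ) (x : E) :
    (inner ℝ (ef j) (projFirst ef K x) : ℝ) = if j < K then inner ℝ (ef j) x else 0 := by
  have : FiniteDimensional ℝ (Submodule.span ℝ (Set.range fun j : Fin K => ef j)) :=
    FiniteDimensional.span_of_finite ℝ (Set.finite_range _)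
  have h : (inner ℝ (ef j) (projFirst ef K x) : ℝ) = inner ℝ (projFirst ef K (ef j)) x :=
    (Submodule.inner_starProjection_left_eq_right _ _ _).symm
  rw [h]
  split_ifs with hj
  · rw [projFirst_apply_of_lt ef hj]
  · rw [projFirst_apply_of_le ef (not_lt.1 hj), inner_zero_left]

theorem norm_projFirst_le (ef : HilbertBasis ℕ ℝ E) (K : ℕ) {x y : E}
    (h : ∀ i < K, |(inner ℝ (ef i) x : ℝ)| ≤ |inner ℝ (ef i) y|) : ‖projFirst ef K x‖ ≤ ‖y‖ := by
  have h1 := IsEigenSystem.hasSum_mul_norm_sq ef 1 (projFirst ef K x)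
  have h2 := IsEigenSystem.hasSum_mul_norm_sq ef 1 y
  have h3 := hasSum_le (fun i => ?_) h1 h2
  · rw [one_mul, one_mul] at h3
    exact le_of_sq_le_sq h3 (norm_nonneg _)
  · rw [inner_projFirst, one_mul, one_mul]
    split_ifs with hi
    · exact sq_le_sq.2 (h i hi)
    · rw [zero_pow two_ne_zero]
      exact sq_nonneg _

/-- Davis-Kahan type bound for an eigenvector that belongs to the lower part of the spectrum. -/
theorem mul_norm_projFirst_le {C C' : E →L[ℝ] E} {ev ev' : ℕ → ℝ} {ef ef' : HilbertBasis ℕ ℝ E}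
    (h : IsEigenSystem C ev ef) (h' : IsEigenSystem C' ev' ef') {K j : ℕ} {g : ℝ} (hg : 0 ≤ g)
    (hgap : ∀ i < K, g ≤ ev i - ev' j) :
    g * ‖projFirst ef K (ef' j)‖ ≤ ‖(C' - C) (ef' j)‖ := by
  -- Absorb g into the argument of the projection; it then suffices to compare coefficients along
  -- the first K vectors of `ef`.
  rw [← abs_of_nonneg hg, ← Real.norm_eq_abs, ← norm_smul, ← map_smul]
  refine norm_projFirst_le ef K fun i hi => ?_
  -- Matrix entries of C' − C between the two eigenbases are eigenvalue differences times overlaps,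
  -- so a gap bounds the overlaps.
  have h1 : (inner ℝ (ef i) ((C' - C) (ef' j)) : ℝ) = (ev' j - ev i) * inner ℝ (ef i) (ef' j) := by
    rw [sub_apply, inner_sub_right, h.inner_apply, h'.2 j, inner_smul_right]
    ring
  rw [h1, inner_smul_right, abs_mul, abs_mul, abs_of_nonneg hg,
    abs_sub_comm]
  gcongr
  exact (hgap i hi).trans (le_abs_self _)

/-! ### Regularized inverse and deterministic error bound -/

theorem inverse_apply_eigenvector {C : E →L[ℝ] E} {ev : ℕ → ℝ} {ef : HilbertBasis ℕ ℝ E}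
    (h : IsEigenSystem C ev ef) {θ : ℝ} (hu : IsUnit (C + θ • ContinuousLinearMap.id ℝ E)) (j : ℕ)
    (hj : ev j + θ ≠ 0) :
    Ring.inverse (C + θ • ContinuousLinearMap.id ℝ E) (ef j) = (ev j + θ)⁻¹ • ef j := by
  have h1 := DFunLike.congr_fun (Ring.inverse_mul_cancel _ hu) (ef j)
  have h2 : (C + θ • ContinuousLinearMap.id ℝ E) (ef j) = (ev j + θ) • ef j := by
    simp [h.2 j, add_smul]
  rw [mul_apply_eq_comp, h2, map_smul] at h1
  rw [eq_inv_smul_iff₀ hj]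
  exact h1

/-- C + θ is coercive with constant θ, so Lax-Milgram applies. Invertibility is essential because
`Ring.inverse` takes the value 0 at non-units. -/
theorem isUnit_add_smul_id {C : E →L[ℝ] E} (hC : ∀ x, 0 ≤ (inner ℝ x (C x) : ℝ)) {θ : ℝ}
    (hθ : 0 < θ) : IsUnit (C + θ • ContinuousLinearMap.id ℝ E) := by
  refine ContinuousLinearMap.isUnit_of_forall_le_norm_inner_map _ (c := ⟨θ, hθ.le⟩) hθ fun x => ?_
  refine le_trans ?_ (le_abs_self _)
  have := hC x
  rw [real_inner_comm]
  simp only [add_apply, smul_apply,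
    ContinuousLinearMap.id_apply, inner_add_right, inner_smul_right, real_inner_self_eq_norm_sq]
  change ‖x‖ ^ 2 * θ ≤ _
  linarith

/-- Error bound for the regularized estimator `D' (C' + θ)⁻¹ Π'` of `A`. -/
theorem hsNormSq_regularized_sub_le {C C' : E →L[ℝ] E} {D' A : E →L[ℝ] F} {ev ev' : ℕ → ℝ}
    {ef ef' : HilbertBasis ℕ ℝ E} (h : IsEigenSystem C ev ef) (h' : IsEigenSystem C' ev' ef')
    {θ l g : ℝ} (hu : IsUnit (C' + θ • ContinuousLinearMap.id ℝ E)) (hl : 0 < l) (hg : 0 < g)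
    {K : ℕ} (hlK : ∀ j < K, l ≤ ev' j + θ) (hgap : ∀ i < K, ∀ j, K ≤ j → g ≤ ev i - ev' j) :
    hsNormSq (D' ∘L Ring.inverse (C' + θ • ContinuousLinearMap.id ℝ E) ∘L projFirst ef' K - A) ≤
      ENNReal.ofReal (3 / l ^ 2) * hsNormSq (D' - A ∘L C) +
      ENNReal.ofReal (3 / l ^ 2 * ‖A‖ ^ 2) * hsNormSq (C' - C) +
      ENNReal.ofReal (3 / l ^ 2 * θ ^ 2) * hsNormSq A +
      ENNReal.ofReal (2 / g ^ 2 * ‖A‖ ^ 2) * hsNormSq (C' - C) +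
      ENNReal.ofReal 2 * hsNormSq (A - A ∘L projFirst ef K) := by
  -- Computing all the H-S norms in the eigenbasis of C' reduces the claim to an inequality for each
  -- basis vector.
  simp_rw [hsNormSq_eq ef', ← ENNReal.tsum_mul_left]
  simp_rw [← ENNReal.tsum_add]
  refine ENNReal.tsum_le_tsum fun j => ?_
  have hA : ∀ x, ‖A x‖ ≤ ‖A‖ * ‖x‖ := A.le_opNorm
  rw [← ENNReal.ofReal_mul (by positivity), ← ENNReal.ofReal_mul (by positivity),
    ← ENNReal.ofReal_mul (by positivity), ← ENNReal.ofReal_mul (by positivity),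
    ← ENNReal.ofReal_mul (by positivity), ← ENNReal.ofReal_add (by positivity) (by positivity),
    ← ENNReal.ofReal_add (by positivity) (by positivity),
    ← ENNReal.ofReal_add (by positivity) (by positivity),
    ← ENNReal.ofReal_add (by positivity) (by positivity)]
  refine ENNReal.ofReal_le_ofReal ?_
  rcases lt_or_ge j K with hj | hj
  · have hpos : 0 < ev' j + θ := hl.trans_le (hlK j hj)
    -- Here (C' + θ)⁻¹ is division by ev' j + θ, and (ev' j + θ) A ĉ_j = A C ĉ_j + A (C' − C) ĉ_j +
    -- θ A ĉ_j.
    have h1 : (D' ∘L Ring.inverse (C' + θ • ContinuousLinearMap.id ℝ E) ∘L projFirst ef' K - A)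
        (ef' j) = (ev' j + θ)⁻¹ • ((D' - A ∘L C) (ef' j) - A ((C' - C) (ef' j)) -
          θ • A (ef' j)) := by
      rw [eq_inv_smul_iff₀ hpos.ne']
      simp only [sub_apply, ContinuousLinearMap.comp_apply,
        projFirst_apply_of_lt ef' hj, inverse_apply_eigenvector h' hu j hpos.ne', map_smul, map_sub,
        h'.2 j, smul_sub, smul_inv_smul₀ hpos.ne', add_smul]
      abel
    have h2 : ‖(ev' j + θ)⁻¹‖ ≤ l⁻¹ := by
      rw [norm_inv, Real.norm_of_nonneg hpos.le]
      exact inv_anti₀ hl (hlK j hj)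
    set u := (D' - A ∘L C) (ef' j)
    set v := (C' - C) (ef' j)
    set w := A (ef' j)
    have h3 : ‖u - A v - θ • w‖ ≤ ‖u‖ + ‖A‖ * ‖v‖ + |θ| * ‖w‖ := by
      refine (norm_sub_le _ _).trans ?_
      rw [norm_smul, Real.norm_eq_abs]
      gcongr
      exact (norm_sub_le _ _).trans (by gcongr; exact hA v)
    have h4 : (‖u‖ + ‖A‖ * ‖v‖ + |θ| * ‖w‖) ^ 2 ≤
        3 * (‖u‖ ^ 2 + (‖A‖ * ‖v‖) ^ 2 + (|θ| * ‖w‖) ^ 2) := by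
      nlinarith [sq_nonneg (‖u‖ - ‖A‖ * ‖v‖), sq_nonneg (‖u‖ - |θ| * ‖w‖),
        sq_nonneg (‖A‖ * ‖v‖ - |θ| * ‖w‖)]
    have h5 : 0 ≤ 2 / g ^ 2 * ‖A‖ ^ 2 * ‖v‖ ^ 2 +
        2 * ‖(A - A ∘L projFirst ef K) (ef' j)‖ ^ 2 := by positivity
    rw [h1, norm_smul, mul_pow]
    calc _ ≤ l⁻¹ ^ 2 * (3 * (‖u‖ ^ 2 + (‖A‖ * ‖v‖) ^ 2 + (|θ| * ‖w‖) ^ 2)) := by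
          gcongr
          exact (pow_le_pow_left₀ (norm_nonneg _) h3 2).trans h4
      _ = 3 / l ^ 2 * ‖u‖ ^ 2 + 3 / l ^ 2 * ‖A‖ ^ 2 * ‖v‖ ^ 2 + 3 / l ^ 2 * θ ^ 2 * ‖w‖ ^ 2 := by
          rw [mul_pow |θ|, sq_abs]; field_simp
      _ ≤ _ := by linarith
  -- Beyond K the estimator is zero; the remaining −A ĉ_j is split through the population
  -- projection.
  · have h1 : (D' ∘L Ring.inverse (C' + θ • ContinuousLinearMap.id ℝ E) ∘L projFirst ef' K - A)
        (ef' j) = -((A - A ∘L projFirst ef K) (ef' j) + A (projFirst ef K (ef' j))) := by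
      simp [projFirst_apply_of_le ef' hj]
    have h2 := mul_norm_projFirst_le h h' hg.le fun i hi => hgap i hi j hj
    set v := (C' - C) (ef' j)
    set w := (A - A ∘L projFirst ef K) (ef' j)
    have h3 : ‖A (projFirst ef K (ef' j))‖ ≤ ‖A‖ * (g⁻¹ * ‖v‖) := by
      refine (hA _).trans ?_
      gcongr
      rwa [le_inv_mul_iff₀ hg]
    have h5 : 0 ≤ 3 / l ^ 2 * ‖(D' - A ∘L C) (ef' j)‖ ^ 2 + 3 / l ^ 2 * ‖A‖ ^ 2 * ‖v‖ ^ 2 +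
        3 / l ^ 2 * θ ^ 2 * ‖A (ef' j)‖ ^ 2 := by positivity
    rw [h1, norm_neg]
    calc _ ≤ (‖w‖ + ‖A‖ * (g⁻¹ * ‖v‖)) ^ 2 := by
          gcongr
          exact (norm_add_le _ _).trans (by gcongr)
      _ ≤ 2 * (‖A‖ * (g⁻¹ * ‖v‖)) ^ 2 + 2 * ‖w‖ ^ 2 := by
          nlinarith [sq_nonneg (‖w‖ - ‖A‖ * (g⁻¹ * ‖v‖))]
      _ = 2 / g ^ 2 * ‖A‖ ^ 2 * ‖v‖ ^ 2 + 2 * ‖w‖ ^ 2 := by field_simp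
      _ ≤ _ := by linarith

/-! ### Consequences of the Sobolev condition -/

theorem ofReal_norm_sq_mul_le_tsum_hsInner (A : E →L[ℝ] F) (c : HilbertBasis ℕ ℝ E)
    (d : HilbertBasis ℕ ℝ F) (i : ℕ) {a : ℝ} (ha : 0 ≤ a) {w : ℕ → ℝ} (hw : ∀ j, a ≤ w j) :
    ENNReal.ofReal a * ENNReal.ofReal (‖A (c i)‖ ^ 2) ≤
      ∑' j, ENNReal.ofReal (hsInner A (tensor (c i) (d j)) ^ 2 * w j) := by
  rw [ofReal_norm_sq_eq_tsum d, ← ENNReal.tsum_mul_left]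
  refine ENNReal.tsum_le_tsum fun j => ?_
  rw [← ENNReal.ofReal_mul ha, hsInner_tensor, mul_comm]
  gcongr
  exact hw j

theorem hsNormSq_le_sobolevSum (A : E →L[ℝ] F) (c : HilbertBasis ℕ ℝ E)
    (d : HilbertBasis ℕ ℝ F) (β : ℝ) : hsNormSq A ≤ sobolevSum A c d β := by
  rw [hsNormSq_eq c]
  refine ENNReal.tsum_le_tsum fun i => ?_
  have := ofReal_norm_sq_mul_le_tsum_hsInner A c d i zero_le_one
    (w := fun j => 1 + ((i : ℝ) + 1) ^ (2 * β) + ((j : ℝ) + 1) ^ (2 * β)) fun j => by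
      have h1 : 0 ≤ ((i : ℝ) + 1) ^ (2 * β) := by positivity
      have h2 : 0 ≤ ((j : ℝ) + 1) ^ (2 * β) := by positivity
      linarith
  simpa using this

/-- Only indices i ≥ K survive in the tail, and there the weight (i + 1)^(2β) is at least K^(2β). -/
theorem hsNormSq_sub_comp_projFirst_le (A : E →L[ℝ] F) (c : HilbertBasis ℕ ℝ E)
    (d : HilbertBasis ℕ ℝ F) {β : ℝ} (hβ : 0 < β) (K : ℕ) :
    ENNReal.ofReal ((K : ℝ) ^ (2 * β)) * hsNormSq (A - A ∘L projFirst c K) ≤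
      sobolevSum A c d β := by
  rw [hsNormSq_eq c, ← ENNReal.tsum_mul_left]
  refine ENNReal.tsum_le_tsum fun i => ?_
  rcases lt_or_ge i K with hi | hi
  · simp [projFirst_apply_of_lt c hi]
  · simp only [sub_apply, ContinuousLinearMap.comp_apply,
      projFirst_apply_of_le c hi, map_zero, sub_zero]
    refine ofReal_norm_sq_mul_le_tsum_hsInner A c d i (by positivity) fun j => ?_
    have h1 : (K : ℝ) ^ (2 * β) ≤ ((i : ℝ) + 1) ^ (2 * β) := by
      gcongr
      have : (K : ℝ) ≤ i := by exact_mod_cast hi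
      linarith
    have h2 : 0 ≤ ((j : ℝ) + 1) ^ (2 * β) := by positivity
    linarith

end Operators

/-! ### Covariance operators and the Yule-Walker equation -/

section Covariance

set_option linter.unusedSectionVars false

variable {Ω : Type*} [MeasurableSpace Ω] {μ : Measure Ω}
  {E F : Type*} [NormedAddCommGroup E] [InnerProductSpace ℝ E]
  [NormedAddCommGroup F] [InnerProductSpace ℝ F]

theorem continuous_tensor : Continuous fun q : E × F => tensor q.1 q.2 := by
  exact (ContinuousLinearMap.smulRightL ℝ E F).continuous₂.comp
    (((innerSL ℝ).continuous.comp continuous_fst).prodMk continuous_snd)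

theorem integrable_tensor {X : Ω → E} {Y : Ω → F} (hX : MemLp X 2 μ) (hY : MemLp Y 2 μ) :
    Integrable (fun ω => tensor (X ω) (Y ω)) μ := by
  have h : Integrable (fun ω => ‖X ω‖ * ‖Y ω‖) μ := hX.norm.integrable_mul hY.norm
  have hm : AEStronglyMeasurable (fun ω => tensor (X ω) (Y ω)) μ :=
    Continuous.comp_aestronglyMeasurable (g := fun q : E × F => tensor q.1 q.2)
      (f := fun ω => (X ω, Y ω)) continuous_tensor
      (hX.aestronglyMeasurable.prodMk hY.aestronglyMeasurable)
  refine h.mono' hm (ae_of_all _ fun ω => ?_)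
  rw [tensor, InnerProductSpace.norm_rankOne, mul_comm]

theorem crossCov_apply {X : Ω → E} {Y : Ω → F} (hX : MemLp X 2 μ) (hY : MemLp Y 2 μ)
    (hX0 : ∫ ω, X ω ∂μ = 0) (hY0 : ∫ ω, Y ω ∂μ = 0) (x : E) :
    crossCov μ X Y x = ∫ ω, (inner ℝ (X ω) x : ℝ) • Y ω ∂μ := by
  simp only [crossCov, hX0, hY0, sub_zero]
  rw [ContinuousLinearMap.integral_apply (integrable_tensor hX hY)]
  simp only [tensor_apply]

theorem integrable_inner_smul {X : Ω → E} {Y : Ω → F} (hX : MemLp X 2 μ) (hY : MemLp Y 2 μ)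
    (x : E) : Integrable (fun ω => (inner ℝ (X ω) x : ℝ) • Y ω) μ := by
  simpa only [tensor_apply] using (integrable_tensor hX hY).apply_continuousLinearMap x

theorem inner_crossCov_self_nonneg [CompleteSpace E] {X : Ω → E} (hX : MemLp X 2 μ)
    (hX0 : ∫ ω, X ω ∂μ = 0) (x : E) : 0 ≤ (inner ℝ x (crossCov μ X X x) : ℝ) := by
  rw [crossCov_apply hX hX hX0 hX0, ← integral_inner (integrable_inner_smul hX hX x)]
  refine integral_nonneg fun ω => ?_
  change (0 : ℝ) ≤ inner ℝ x ((inner ℝ (X ω) x : ℝ) • X ω)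
  rw [inner_smul_right, real_inner_comm]
  exact mul_self_nonneg _

/-- The Yule-Walker equation. -/
theorem crossCov_eq_comp [CompleteSpace E] [CompleteSpace F] {X : Ω → E} {Y e : Ω → F}
    {A : E →L[ℝ] F} (hX : MemLp X 2 μ)
    (he : MemLp e 2 μ) (hX0 : ∫ ω, X ω ∂μ = 0) (hY0 : ∫ ω, Y ω ∂μ = 0) (he0 : ∫ ω, e ω ∂μ = 0)
    (hY : Y =ᵐ[μ] fun ω => e ω + A (X ω)) (hXe : crossCov μ X e = 0) :
    crossCov μ X Y = A ∘L crossCov μ X X := by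
  have hY2 : MemLp Y 2 μ := (he.add (A.comp_memLp' hX)).ae_eq hY.symm
  ext x
  rw [ContinuousLinearMap.comp_apply, crossCov_apply hX hX hX0 hX0, crossCov_apply hX hY2 hX0 hY0,
    ← A.integral_comp_comm (integrable_inner_smul hX hX x)]
  have h1 := crossCov_apply hX he hX0 he0 x
  rw [hXe, zero_apply] at h1
  -- The zero inserted here is the cross-covariance of X and e at x, which supplies the noise part
  -- of Y.
  rw [← zero_add (∫ ω, A _ ∂μ), h1, ← integral_add (integrable_inner_smul hX he x)
    (A.integrable_comp (integrable_inner_smul hX hX x))]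
  refine integral_congr_ae (hY.mono fun ω hω => ?_)
  simp only [hω, smul_add, map_smul]

end Covariance

/-! ### Lag vectors and components -/

section Lag

set_option linter.unusedSectionVars false

variable {Ω : Type*} [MeasurableSpace Ω] {μ : Measure Ω}
  {H : Type*} [NormedAddCommGroup H] [InnerProductSpace ℝ H] [CompleteSpace H] {X ε : ℤ → Ω → H}

theorem memLp_lagVec (hX : ∀ k, MemLp (X k) 2 μ) (L : ℕ) (k : ℤ) :
    MemLp (lagVec X L k) 2 μ :=
  memLp_piLp_iff.2 fun i => hX (k - (i : ℕ))

theorem integral_lagVec (hX : IsCentered μ X) (L : ℕ) (k : ℤ) :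
    ∫ ω, lagVec X L k ω ∂μ = 0 := by
  ext i
  rw [eval_integral_piLp fun i : Fin L => (hX (k - (i : ℕ))).1]
  exact (hX (k - (i : ℕ))).2

theorem crossCov_lagVec_eq_zero {L : ℕ} {k : ℤ} {e : Ω → H} (hX : ∀ k, MemLp (X k) 2 μ)
    (hX0 : IsCentered μ X) (he : MemLp e 2 μ) (he0 : ∫ ω, e ω ∂μ = 0)
    (h : ∀ i : Fin L, crossCov μ (X (k - (i : ℕ))) e = 0) : crossCov μ (lagVec X L k) e = 0 := by
  ext x
  rw [crossCov_apply (memLp_lagVec hX L k) he (integral_lagVec hX0 L k) he0, zero_apply]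
  simp only [lagVec, PiLp.inner_apply, Finset.sum_smul]
  rw [integral_finsetSum _ fun i _ => integrable_inner_smul (hX _) he _]
  refine Finset.sum_eq_zero fun i _ => ?_
  rw [← crossCov_apply (hX _) he (hX0 _).2 he0, h i, zero_apply]

/-- The autoregressive equation at time 1 reads X_1 = ε_1 + A_p X_0^{[p]}, and every coordinate
X_{-i} of the lag vector precedes ε_1 by i + 1 steps. -/
theorem IsFAR.crossCov_lagVec {p : ℕ} {α : Fin p → H →L[ℝ] H} (h : IsFAR μ p α X ε)
    (hX : ∀ k, MemLp (X k) 2 μ)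
    (hpast : ∀ (k : ℤ) (j : ℕ), 1 ≤ j → crossCov μ (X (k - j)) (ε k) = 0) :
    crossCov μ (lagVec X p 0) (X 1) =
      rowOp α ∘L crossCov μ (lagVec X p 0) (lagVec X p 0) := by
  have he := h.whiteNoise.2.1.1 1
  have he0 := (h.whiteNoise.1 1).2
  refine crossCov_eq_comp (memLp_lagVec hX p 0) he (integral_lagVec h.centered p 0)
    (h.centered 1).2 he0 ((h.eqn 1).mono fun ω hω => ?_)
    (crossCov_lagVec_eq_zero hX h.centered he he0 fun i => ?_)
  · rw [hω]
    congr 1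
    simp only [rowOp, lagVec, sum_apply, ContinuousLinearMap.comp_apply, PiLp.proj_apply]
    refine Finset.sum_congr rfl fun i _ => ?_
    congr 2
    ring
  · have := hpast 1 (i + 1) (by omega)
    rwa [show (1 : ℤ) - ((i + 1 : ℕ) : ℤ) = 0 - ((i : ℕ) : ℤ) by push_cast; ring] at this

theorem inner_empCov_nonneg {Ω : Type*} (X : ℤ → Ω → H) {L N : ℕ} (h : L ≤ N) (ω : Ω)
    (x : Pow H L) :
    0 ≤ (inner ℝ x (empCov X L N ω x) : ℝ) := by
  have hN : (0 : ℝ) ≤ (N : ℝ) - L + 1 := by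
    have : (L : ℝ) ≤ N := by exact_mod_cast h
    linarith
  rw [empCov, smul_apply, inner_smul_right, sum_apply, inner_sum]
  refine mul_nonneg (inv_nonneg.2 hN) (Finset.sum_nonneg fun k _ => ?_)
  rw [tensor_apply, inner_smul_right, real_inner_comm]
  exact mul_self_nonneg _

/-- A component is the operator composed with a coordinate embedding, which is isometric. -/
theorem hsNormSq_component_le {L : ℕ} (A : Pow H L →L[ℝ] H) (i : Fin L) :
    hsNormSq (component A i) ≤ hsNormSq A := by
  refine (hsNormSq_comp_le' A _).trans ?_
  have h1 : ‖((PiLp.continuousLinearEquiv 2 ℝ (fun _ : Fin L => H)).symm.toContinuousLinearMap ∘L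
      ContinuousLinearMap.single ℝ (fun _ : Fin L => H) i)‖ ≤ 1 := by
    refine ContinuousLinearMap.opNorm_le_bound _ zero_le_one fun x => ?_
    rw [one_mul]
    exact (PiLp.norm_single 2 (fun _ : Fin L => H) i x).le
  calc _ ≤ ENNReal.ofReal (1 ^ 2) * hsNormSq A := by gcongr
    _ = hsNormSq A := by simp

theorem component_sub {L : ℕ} (A B : Pow H L →L[ℝ] H) (i : Fin L) :
    component (A - B) i = component A i - component B i := by
  simp only [component, ContinuousLinearMap.sub_comp]

theorem hsNorm_component_sub_le {L : ℕ} (A : Pow H L →L[ℝ] H) (α : Fin L → H →L[ℝ] H)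
    (i : Fin L) : hsNorm (component A i - α i) ≤ hsNorm (A - rowOp α) := by
  have h : component A i - α i = component (A - rowOp α) i := by
    rw [component_sub, component_rowOp]
  rw [h]
  exact ENNReal.rpow_le_rpow (hsNormSq_component_le _ i) (by norm_num)

end Lag

/-! ### Tuning parameters -/

section Rates

theorem inv_gap_le_invGap (lam : ℕ → ℝ) {K j : ℕ} (hj : j < K) :
    (lam j - lam (j + 1))⁻¹ ≤ invGap lam K :=
  le_ciSup (f := fun j : Fin K => (lam j - lam (j + 1))⁻¹) (Set.finite_range _).bddAbove ⟨j, hj⟩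

/-- Under the conditions on the tuning parameters, both `K Λ_K p² N^(-1/2)` and `θ_N` are
`O(K^(-β) λ_K)`. -/
theorem exists_eventually_tuning_le {p : ℕ} {lam : ℕ → ℝ} {β : ℝ} {K : ℕ → ℕ} {θ : ℕ → ℝ}
    (hpos : ∀ j, 0 < lam j) (hK : Tendsto K atTop atTop)
    (hKrate : (fun N => (K N : ℝ) ^ (1 + β) * (lam (K N - 1))⁻¹ * invGap lam (K N) *
      (p : ℝ) ^ 2) =O[atTop] fun N : ℕ => (N : ℝ) ^ (1 / 2 : ℝ))
    (hθrate : θ =o[atTop] fun N : ℕ => (K N : ℝ) * invGap lam (K N) * (p : ℝ) ^ 2 *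
      (N : ℝ) ^ (-(1 / 2) : ℝ)) :
    ∃ c : ℝ, 0 < c ∧ ∀ᶠ N : ℕ in atTop,
      (K N : ℝ) * invGap lam (K N) * (p : ℝ) ^ 2 * (N : ℝ) ^ (-(1 / 2) : ℝ) ≤
        c * (K N : ℝ) ^ (-β) * lam (K N - 1) ∧
      θ N ≤ c * (K N : ℝ) ^ (-β) * lam (K N - 1) := by
  obtain ⟨c, hc, hcN⟩ := hKrate.exists_pos
  refine ⟨c, hc, ?_⟩
  filter_upwards [hcN.bound, hθrate.bound one_pos, hK.eventually_ge_atTop 1,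
    eventually_ge_atTop 1] with N h1 h2 hK1 hN
  have hK0 : (0 : ℝ) < K N := by exact_mod_cast hK1
  have hN0 : (0 : ℝ) < N := by exact_mod_cast hN
  have hl := hpos (K N - 1)
  have hx : 0 < (K N : ℝ) ^ (-β) := Real.rpow_pos_of_pos hK0 _
  have hr : 0 < (N : ℝ) ^ (-(1 / 2) : ℝ) := Real.rpow_pos_of_pos hN0 _
  have key : |(K N : ℝ) * invGap lam (K N) * (p : ℝ) ^ 2 * (N : ℝ) ^ (-(1 / 2) : ℝ)| ≤
      c * (K N : ℝ) ^ (-β) * lam (K N - 1) := by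
    -- Factor out the quantity bounded by `hKrate`; its bound c N^(1/2) cancels the remaining
    -- N^(-1/2).
    have e1 : (K N : ℝ) * invGap lam (K N) * (p : ℝ) ^ 2 * (N : ℝ) ^ (-(1 / 2) : ℝ) =
        ((K N : ℝ) ^ (1 + β) * (lam (K N - 1))⁻¹ * invGap lam (K N) * (p : ℝ) ^ 2) *
          ((N : ℝ) ^ (-(1 / 2) : ℝ) * (K N : ℝ) ^ (-β) * lam (K N - 1)) := by
      have e2 : (K N : ℝ) ^ (1 + β) * (K N : ℝ) ^ (-β) = K N := by
        rw [← Real.rpow_add hK0]; simp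
      have e3 : (lam (K N - 1))⁻¹ * lam (K N - 1) = 1 := inv_mul_cancel₀ hl.ne'
      linear_combination (-(invGap lam (K N) * (p : ℝ) ^ 2 * (N : ℝ) ^ (-(1 / 2) : ℝ))) * e2 -
        ((K N : ℝ) ^ (1 + β) * (K N : ℝ) ^ (-β) * invGap lam (K N) * (p : ℝ) ^ 2 *
          (N : ℝ) ^ (-(1 / 2) : ℝ)) * e3
    rw [e1, abs_mul, abs_of_pos (mul_pos (mul_pos hr hx) hl)]
    refine (mul_le_mul_of_nonneg_right h1 (mul_pos (mul_pos hr hx) hl).le).trans_eq ?_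
    rw [Real.norm_of_nonneg (by positivity)]
    have e4 : (N : ℝ) ^ (1 / 2 : ℝ) * (N : ℝ) ^ (-(1 / 2) : ℝ) = 1 := by
      rw [← Real.rpow_add hN0]; simp
    linear_combination (c * (K N : ℝ) ^ (-β) * lam (K N - 1)) * e4
  refine ⟨(le_abs_self _).trans key, (le_abs_self _).trans (h2.trans ?_)⟩
  rw [one_mul]
  exact key

/-- A radius `B N^(-1/2)` of the confidence set is eventually below half of `λ_K` and half of the
spectral gap, and it is `O(K^(-β))` relative to both. -/
theorem exists_eventually_radius_le {p : ℕ} {lam : ℕ → ℝ} {β : ℝ} {K : ℕ → ℕ} {θ : ℕ → ℝ}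
    (hp : 1 ≤ p) (hβ : 0 < β) (hpos : ∀ j, 0 < lam j) (hlt : ∀ j, lam (j + 1) < lam j)
    (hK : Tendsto K atTop atTop)
    (hKrate : (fun N => (K N : ℝ) ^ (1 + β) * (lam (K N - 1))⁻¹ * invGap lam (K N) *
      (p : ℝ) ^ 2) =O[atTop] fun N : ℕ => (N : ℝ) ^ (1 / 2 : ℝ))
    (hθrate : θ =o[atTop] fun N : ℕ => (K N : ℝ) * invGap lam (K N) * (p : ℝ) ^ 2 *
      (N : ℝ) ^ (-(1 / 2) : ℝ)) {B : ℝ} (hB0 : 0 < B) :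
    ∃ m : ℝ, 0 < m ∧ ∀ᶠ N : ℕ in atTop, 1 ≤ K N ∧ 0 < lam (K N - 1) - lam (K N) ∧
      2 * (B * (N : ℝ) ^ (-(1 / 2) : ℝ)) ≤ lam (K N - 1) ∧
      2 * (B * (N : ℝ) ^ (-(1 / 2) : ℝ)) ≤ lam (K N - 1) - lam (K N) ∧
      B * (N : ℝ) ^ (-(1 / 2) : ℝ) ≤ m * (K N : ℝ) ^ (-β) * lam (K N - 1) ∧
      θ N ≤ m * (K N : ℝ) ^ (-β) * lam (K N - 1) ∧
      B * (N : ℝ) ^ (-(1 / 2) : ℝ) ≤ m * (K N : ℝ) ^ (-β) * (lam (K N - 1) - lam (K N)) := by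
  have hp1 : (1 : ℝ) ≤ p := by exact_mod_cast hp
  obtain ⟨m, hm, hrate⟩ := exists_eventually_tuning_le hpos hK hKrate hθrate
  have hg0 : 0 < lam 0 - lam 1 := sub_pos.2 (hlt 0)
  have hl0 := hpos 0
  have hanti : Antitone lam := antitone_nat_of_succ_le fun j => (hlt j).le
  -- The three summands serve θ, the comparison with λ_K (through 1 ≤ (λ_1 − λ_2) Λ_K) and the
  -- comparison with the gap (through 1 ≤ (λ_K − λ_{K+1}) Λ_K and λ_K ≤ λ_1).
  obtain ⟨m', hm'⟩ : ∃ m', m' = m + B * m * (lam 0 - lam 1) + B * m * lam 0 := ⟨_, rfl⟩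
  have hm'0 : 0 < m' := by rw [hm']; positivity
  have hmm : m ≤ m' := by
    have h1 : 0 ≤ B * m * lam 0 := by positivity
    have h2 : 0 ≤ B * m * (lam 0 - lam 1) := by positivity
    linarith
  refine ⟨m', hm'0, ?_⟩
  filter_upwards [hrate, hK.eventually_ge_atTop 1, eventually_ge_atTop 1,
    (tendsto_natCast_atTop_atTop (R := ℝ)).comp hK |>.eventually_ge_atTop (2 * m')] with N ⟨hr1, hr2⟩ hK1 hN1 hKm
  have hN0 : (0 : ℝ) < N := by exact_mod_cast hN1
  have hK0 : (1 : ℝ) ≤ K N := by exact_mod_cast hK1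
  have hr : 0 < (N : ℝ) ^ (-(1 / 2) : ℝ) := Real.rpow_pos_of_pos hN0 _
  have hx : 0 < (K N : ℝ) ^ (-β) := Real.rpow_pos_of_pos (by linarith) _
  have hx1 : (K N : ℝ) ^ (-β) ≤ 1 := Real.rpow_le_one_of_one_le_of_nonpos hK0 (by linarith)
  have hKm' : 2 * m' ≤ K N := hKm
  set r : ℝ := (N : ℝ) ^ (-(1 / 2) : ℝ)
  set x : ℝ := (K N : ℝ) ^ (-β)
  have hsucc : K N - 1 + 1 = K N := Nat.sub_add_cancel hK1
  have hl := hpos (K N - 1)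
  have hg : 0 < lam (K N - 1) - lam (K N) := sub_pos.2 (by simpa [hsucc] using hlt (K N - 1))
  have hL0 : (lam 0 - lam 1)⁻¹ ≤ invGap lam (K N) := inv_gap_le_invGap lam hK1
  have hL1 : (lam (K N - 1) - lam (K N))⁻¹ ≤ invGap lam (K N) := by
    simpa [hsucc] using inv_gap_le_invGap lam (Nat.sub_lt hK1 one_pos)
  have hL : 0 < invGap lam (K N) := (inv_pos.2 hg0).trans_le hL0
  have hKL : (K N : ℝ) * (invGap lam (K N) * r) ≤ m * x * lam (K N - 1) := by
    refine le_trans ?_ hr1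
    have : 0 ≤ (K N : ℝ) * invGap lam (K N) * r := by positivity
    nlinarith [one_le_pow₀ hp1 (n := 2)]
  have hblam : K N * (B * r) ≤ m' * x * lam (K N - 1) := by
    have e1 : r ≤ (lam 0 - lam 1) * (invGap lam (K N) * r) := by
      rw [inv_le_iff_one_le_mul₀' hg0] at hL0
      nlinarith
    calc (K N : ℝ) * (B * r) ≤ K N * (B * ((lam 0 - lam 1) * (invGap lam (K N) * r))) := by
          gcongr
      _ = B * (lam 0 - lam 1) * (K N * (invGap lam (K N) * r)) := by ring
      _ ≤ B * (lam 0 - lam 1) * (m * x * lam (K N - 1)) := by gcongr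
      _ = (B * m * (lam 0 - lam 1)) * x * lam (K N - 1) := by ring
      _ ≤ m' * x * lam (K N - 1) := by
          gcongr
          have : 0 ≤ B * m * lam 0 := by positivity
          linarith
  have hbgap : K N * (B * r) ≤ m' * x * (lam (K N - 1) - lam (K N)) := by
    have e1 : r ≤ (lam (K N - 1) - lam (K N)) * (invGap lam (K N) * r) := by
      rw [inv_le_iff_one_le_mul₀' hg] at hL1
      nlinarith
    calc (K N : ℝ) * (B * r)
        ≤ K N * (B * ((lam (K N - 1) - lam (K N)) * (invGap lam (K N) * r))) := by gcongr
      _ = B * (lam (K N - 1) - lam (K N)) * (K N * (invGap lam (K N) * r)) := by ring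
      _ ≤ B * (lam (K N - 1) - lam (K N)) * (m * x * lam 0) := by
          exact mul_le_mul_of_nonneg_left (hKL.trans (mul_le_mul_of_nonneg_left
            (hanti (Nat.zero_le _)) (by positivity))) (by positivity)
      _ = (B * m * lam 0) * x * (lam (K N - 1) - lam (K N)) := by ring
      _ ≤ m' * x * (lam (K N - 1) - lam (K N)) := by
          gcongr
          have : 0 ≤ B * m * (lam 0 - lam 1) := by positivity
          linarith
  -- The surplus factor K is used twice: K ≥ 1 gives the rate, and K ≥ 2m' gives the factor 2 needed
  -- for Weyl's inequality.
  have hstep : ∀ z : ℝ, 0 < z → K N * (B * r) ≤ m' * x * z →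
      B * r ≤ m' * x * z ∧ 2 * (B * r) ≤ z := by
    intro z hz hle
    have hb0 : 0 ≤ B * r := by positivity
    refine ⟨by nlinarith, ?_⟩
    have e1 : 2 * m' * (B * r) ≤ m' * z := by
      calc 2 * m' * (B * r) ≤ K N * (B * r) := by gcongr
        _ ≤ m' * x * z := hle
        _ ≤ m' * 1 * z := by gcongr
        _ = m' * z := by ring
    nlinarith
  exact ⟨hK1, hg, (hstep _ hl hblam).2, (hstep _ hg hbgap).2, (hstep _ hl hblam).1,
    hr2.trans (by gcongr), (hstep _ hg hbgap).1⟩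

/-! ### Error bound at rate K^(-β) and passage to probability -/

variable {E F : Type*} [NormedAddCommGroup E] [InnerProductSpace ℝ E] [CompleteSpace E]
  [NormedAddCommGroup F] [InnerProductSpace ℝ F] [CompleteSpace F]

/-- Error bound for the regularized estimator in terms of the error `b` of the estimated covariance
operators. -/
theorem hsNorm_regularized_sub_le {C C' : E →L[ℝ] E} {D' A : E →L[ℝ] F} {lam lam' : ℕ → ℝ}
    {c c' : HilbertBasis ℕ ℝ E} (h : IsEigenSystem C lam c) (h' : IsEigenSystem C' lam' c')
    (hC' : ∀ x, 0 ≤ (inner ℝ x (C' x) : ℝ)) (d : HilbertBasis ℕ ℝ F) {β S : ℝ} (hβ : 0 < β)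
    (hS0 : 0 ≤ S) (hS : sobolevSum A c d β ≤ ENNReal.ofReal S) {θ b : ℝ} (hθ : 0 < θ) (hb : 0 ≤ b)
    (hC : hsNormSq (C' - C) ≤ ENNReal.ofReal (b ^ 2))
    (hD : hsNormSq (D' - A ∘L C) ≤ ENNReal.ofReal (b ^ 2)) {K : ℕ} (hK : 1 ≤ K)
    (hlam : 0 < lam (K - 1)) (hgap : 0 < lam (K - 1) - lam K) (hblam : 2 * b ≤ lam (K - 1))
    (hbgap : 2 * b ≤ lam (K - 1) - lam K) {m : ℝ}
    (h1 : b ≤ m * (K : ℝ) ^ (-β) * lam (K - 1)) (h2 : θ ≤ m * (K : ℝ) ^ (-β) * lam (K - 1))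
    (h3 : b ≤ m * (K : ℝ) ^ (-β) * (lam (K - 1) - lam K)) :
    hsNorm (D' ∘L Ring.inverse (C' + θ • ContinuousLinearMap.id ℝ E) ∘L projFirst c' K - A) ≤
      ENNReal.ofReal (√(12 * m ^ 2 + 12 * m ^ 2 * ‖A‖ ^ 2 + 12 * m ^ 2 * S +
        8 * m ^ 2 * ‖A‖ ^ 2 + 2 * S) * (K : ℝ) ^ (-β)) := by
  have hK0 : (0 : ℝ) < K := by exact_mod_cast hK
  have hx : 0 < (K : ℝ) ^ (-β) := Real.rpow_pos_of_pos hK0 _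
  set x : ℝ := (K : ℝ) ^ (-β) with hxdef
  set l := lam (K - 1)
  set g := l - lam K
  have hnorm : ‖C' - C‖ ≤ b := norm_le_of_hsNormSq_le hb hC
  have hw : ∀ j, |lam' j - lam j| ≤ b := fun j => (h.norm_sub_le h' j).trans hnorm
  have main := hsNormSq_regularized_sub_le (D' := D') (A := A) h h' (θ := θ) (l := l / 2)
    (g := g / 2) (isUnit_add_smul_id hC' hθ) (by positivity) (by positivity) (K := K)
    -- Weyl at the K-th eigenvalue: λ̂_j ≥ λ̂_K ≥ λ_K − b ≥ λ_K/2. With indices from 0, λ_K is `lam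
    -- (K - 1)`.
    (fun j hj => by
      have e1 : lam' (K - 1) ≤ lam' j := h'.1 (by omega)
      have e2 := (abs_le.1 (hw (K - 1))).1
      change l / 2 ≤ _
      linarith)
    -- Weyl at the (K+1)-th eigenvalue: λ_i − λ̂_j ≥ λ_K − λ_{K+1} − b, at least half the gap.
    (fun i hi j hj => by
      have e1 : lam (K - 1) ≤ lam i := h.1 (by omega)
      have e2 : lam' j ≤ lam' K := h'.1 hj
      have e3 := (abs_le.1 (hw K)).2
      change (l - lam K) / 2 ≤ _
      linarith)
  have hA : hsNormSq A ≤ ENNReal.ofReal S := (hsNormSq_le_sobolevSum A c d β).trans hS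
  have htail : hsNormSq (A - A ∘L projFirst c K) ≤ ENNReal.ofReal (x ^ 2 * S) := by
    have e0 : (K : ℝ) ^ (2 * β) = (x ^ 2)⁻¹ := by
      rw [hxdef, ← Real.rpow_natCast, ← Real.rpow_mul hK0.le, ← Real.rpow_neg hK0.le]
      congr 1
      push_cast
      ring
    have e1 := (hsNormSq_sub_comp_projFirst_le A c d hβ K).trans hS
    rw [e0] at e1
    calc hsNormSq (A - A ∘L projFirst c K)
        = ENNReal.ofReal (x ^ 2) * (ENNReal.ofReal ((x ^ 2)⁻¹) *
            hsNormSq (A - A ∘L projFirst c K)) := by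
          rw [← mul_assoc, ← ENNReal.ofReal_mul (by positivity), mul_inv_cancel₀ (by positivity),
            ENNReal.ofReal_one, one_mul]
      _ ≤ ENNReal.ofReal (x ^ 2) * ENNReal.ofReal S := by gcongr
      _ = ENNReal.ofReal (x ^ 2 * S) := (ENNReal.ofReal_mul (by positivity)).symm
  rw [hsNorm_le_ofReal_iff (by positivity), mul_pow, Real.sq_sqrt (by positivity)]
  -- Halving l and g costs a factor 4, so the coefficients 3, 3, 3, 2 of the error bound become 12,
  -- 12, 12, 8.
  have hsq : ∀ {y z w : ℝ}, 0 ≤ y → 0 < z → y ≤ m * x * z →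
      w / (z / 2) ^ 2 * y ^ 2 = w * 4 * (y / z) ^ 2 ∧ (y / z) ^ 2 ≤ m ^ 2 * x ^ 2 := by
    intro y z w hy hz hyz
    refine ⟨by field_simp; ring, ?_⟩
    rw [← mul_pow]
    gcongr
    rwa [div_le_iff₀ hz]
  have q1 := hsq (w := 3) hb hlam h1
  have q2 := hsq (w := 3) hθ.le hlam h2
  have q3 := hsq (w := 2) hb hgap h3
  calc _ ≤ _ := main
    _ ≤ ENNReal.ofReal (3 / (l / 2) ^ 2) * ENNReal.ofReal (b ^ 2) +
      ENNReal.ofReal (3 / (l / 2) ^ 2 * ‖A‖ ^ 2) * ENNReal.ofReal (b ^ 2) +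
      ENNReal.ofReal (3 / (l / 2) ^ 2 * θ ^ 2) * ENNReal.ofReal S +
      ENNReal.ofReal (2 / (g / 2) ^ 2 * ‖A‖ ^ 2) * ENNReal.ofReal (b ^ 2) +
      ENNReal.ofReal 2 * ENNReal.ofReal (x ^ 2 * S) := by gcongr
    _ = ENNReal.ofReal (3 / (l / 2) ^ 2 * b ^ 2 + 3 / (l / 2) ^ 2 * b ^ 2 * ‖A‖ ^ 2 +
      3 / (l / 2) ^ 2 * θ ^ 2 * S + 2 / (g / 2) ^ 2 * b ^ 2 * ‖A‖ ^ 2 + 2 * (x ^ 2 * S)) := by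
      rw [ENNReal.ofReal_add (by positivity) (by positivity),
        ENNReal.ofReal_add (by positivity) (by positivity),
        ENNReal.ofReal_add (by positivity) (by positivity),
        ENNReal.ofReal_add (by positivity) (by positivity)]
      simp only [← ENNReal.ofReal_mul zero_le_two]
      rw [← ENNReal.ofReal_mul (by positivity), ← ENNReal.ofReal_mul (by positivity),
        ← ENNReal.ofReal_mul (by positivity), ← ENNReal.ofReal_mul (by positivity),
        mul_right_comm (3 / (l / 2) ^ 2) (‖A‖ ^ 2), mul_right_comm (2 / (g / 2) ^ 2) (‖A‖ ^ 2)]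
    _ ≤ _ := by
      refine ENNReal.ofReal_le_ofReal ?_
      rw [q1.1, q2.1, q3.1]
      have := mul_le_mul_of_nonneg_right q1.2 (sq_nonneg ‖A‖)
      have := mul_le_mul_of_nonneg_right q3.2 (sq_nonneg ‖A‖)
      have := mul_le_mul_of_nonneg_right q2.2 hS0
      linarith [q1.2]

/-- Each rate is taken at level δ/2; outside the two exceptional events the pathwise implication
applies. Subadditivity of μ needs no measurability of these events. -/
theorem IsBigOInProb.of_forall_bound {Ω : Type*} [MeasurableSpace Ω] {μ : Measure Ω}
    {Y₁ Y₂ Z : ℕ → Ω → ℝ≥0∞} {a₁ a₂ a : ℕ → ℝ} (h₁ : IsBigOInProb μ Y₁ a₁)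
    (h₂ : IsBigOInProb μ Y₂ a₂)
    (h : ∀ M₁ M₂ : ℝ, 0 < M₁ → 0 < M₂ → ∃ M : ℝ, 0 < M ∧ ∀ᶠ N in atTop, ∀ ω,
      Y₁ N ω ≤ ENNReal.ofReal (M₁ * a₁ N) → Y₂ N ω ≤ ENNReal.ofReal (M₂ * a₂ N) →
        Z N ω ≤ ENNReal.ofReal (M * a N)) : IsBigOInProb μ Z a := by
  intro δ hδ
  obtain ⟨M₁, hM₁, h₁⟩ := h₁ (δ / 2) (half_pos hδ)
  obtain ⟨M₂, hM₂, h₂⟩ := h₂ (δ / 2) (half_pos hδ)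
  obtain ⟨M, hM, h⟩ := h M₁ M₂ hM₁ hM₂
  refine ⟨M, hM, ?_⟩
  filter_upwards [h₁, h₂, h] with N h₁ h₂ h
  have hsub : {ω | ENNReal.ofReal (M * a N) < Z N ω} ⊆
      {ω | ENNReal.ofReal (M₁ * a₁ N) < Y₁ N ω} ∪ {ω | ENNReal.ofReal (M₂ * a₂ N) < Y₂ N ω} := by
    intro ω hω
    by_contra hcon
    rw [Set.mem_union, not_or] at hcon
    exact absurd (h ω (not_lt.1 hcon.1) (not_lt.1 hcon.2)) (not_le.2 hω)
  calc _ ≤ _ := measure_mono hsub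
    _ ≤ _ := measure_union_le _ _
    _ ≤ ENNReal.ofReal (δ / 2) + ENNReal.ofReal (δ / 2) := add_le_add h₁ h₂
    _ = ENNReal.ofReal δ := by
      rw [← ENNReal.ofReal_add (half_pos hδ).le (half_pos hδ).le, add_halves]

end Rates

end FAR

/-! ### Assembly -/

theorem mainTheorem6
    {H : Type*} [NormedAddCommGroup H] [InnerProductSpace ℝ H] [CompleteSpace H]
    [TopologicalSpace.SeparableSpace H] [MeasurableSpace H] [BorelSpace H]
    (hH : ¬ FiniteDimensional ℝ H)
    {Ω : Type*} [MeasurableSpace Ω] (μ : Measure Ω) [IsProbabilityMeasure μ]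
    -- the fAR(p) process
    (p : ℕ) (α : Fin p → H →L[ℝ] H) (X ε : ℤ → Ω → H)
    (hFAR : FAR.IsFAR μ p α X ε)
    (hXstat : FAR.IsStationary μ X) (hX2 : ∀ k, MemLp (X k) 2 μ)
    (hεstat : FAR.IsStationary μ ε) (hεerg : FAR.IsErgodic μ ε) (hε4 : ∀ k, MemLp (ε k) 4 μ)
    (hpast : ∀ (k : ℤ) (j : ℕ), 1 ≤ j → FAR.crossCov μ (X (k - j)) (ε k) = 0)
    (hεinj : Function.Injective (FAR.crossCov μ (ε 0) (ε 0)))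
    -- rates of the empirical covariance operators
    (hCrate : FAR.IsBigOInProb μ
      (fun N ω => FAR.hsNorm (FAR.empCov X p N ω -
        FAR.crossCov μ (FAR.lagVec X p 0) (FAR.lagVec X p 0)))
      (fun N => (p : ℝ) ^ (3 / 2 : ℝ) * (N : ℝ) ^ (-(1 / 2) : ℝ)))
    (hDrate : FAR.IsBigOInProb μ
      (fun N ω => FAR.hsNorm (FAR.empCross X p N ω -
        FAR.crossCov μ (FAR.lagVec X p 0) (X 1)))
      (fun N => (p : ℝ) * (N : ℝ) ^ (-(1 / 2) : ℝ)))
    -- eigenpairs of the covariance operators of the lag vector and of the process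
    (lam : ℕ → ℝ) (c : HilbertBasis ℕ ℝ (FAR.Pow H p))
    (hc : FAR.IsEigenSystem (FAR.crossCov μ (FAR.lagVec X p 0) (FAR.lagVec X p 0)) lam c)
    (hlam : ∀ j, lam j ≠ lam (j + 1))
    (nu : ℕ → ℝ) (d : HilbertBasis ℕ ℝ H)
    (hd : FAR.IsEigenSystem (FAR.crossCov μ (X 0) (X 0)) nu d)
    -- Hilbert-Schmidt and Sobolev type conditions
    (hHS : ∀ i, FAR.IsHilbertSchmidt (α i))
    (β : ℝ) (hβ : 0 < β) (hSob : FAR.sobolevSum (FAR.rowOp α) c d β < ∞)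
    -- tuning parameters
    (K : ℕ → ℕ) (hK : Tendsto K atTop atTop)
    (θ : ℕ → ℝ) (hθpos : ∀ N, 0 < θ N) (hθ : Tendsto θ atTop (𝓝 0))
    (hθlam : θ =o[atTop] fun N => lam (K N - 1))
    (hKrate : (fun N => (K N : ℝ) ^ (1 + β) * (lam (K N - 1))⁻¹ * FAR.invGap lam (K N) *
      (p : ℝ) ^ 2) =O[atTop] fun N : ℕ => (N : ℝ) ^ (1 / 2 : ℝ))
    (hθrate : θ =o[atTop] fun N : ℕ => (K N : ℝ) * FAR.invGap lam (K N) * (p : ℝ) ^ 2 *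
      (N : ℝ) ^ (-(1 / 2) : ℝ))
    -- eigenpairs of the empirical covariance operators
    (lamHat : ℕ → Ω → ℕ → ℝ) (cHat : ℕ → Ω → HilbertBasis ℕ ℝ (FAR.Pow H p))
    (hcHat : ∀ N ω, FAR.IsEigenSystem (FAR.empCov X p N ω) (lamHat N ω) (cHat N ω)) :
    ∀ i : Fin p, FAR.IsBigOInProb μ
      (fun N ω => FAR.hsNorm
        (FAR.component (FAR.estimator X p N (K N) (θ N) ω (cHat N ω)) i - α i))
      (fun N => (K N : ℝ) ^ (-β)) := by
  have hp : (0 : ℝ) < p := by exact_mod_cast hFAR.order_pos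
  have hlam0 : ∀ j, 0 ≤ lam j := hc.eigenvalue_nonneg
    (FAR.inner_crossCov_self_nonneg (FAR.memLp_lagVec hX2 p 0)
      (FAR.integral_lagVec hFAR.centered p 0))
  have hlt : ∀ j, lam (j + 1) < lam j := fun j => lt_of_le_of_ne (hc.1 j.le_succ) (hlam j).symm
  -- Each eigenvalue strictly exceeds the next, which is nonnegative.
  have hpos : ∀ j, 0 < lam j := fun j => (hlam0 _).trans_lt (hlt j)
  have hYW := hFAR.crossCov_lagVec hX2 hpast
  intro i
  refine hCrate.of_forall_bound hDrate fun M₁ M₂ hM₁ hM₂ => ?_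
  -- As p is fixed, both powers of p go into one constant, so b = B N^(-1/2) serves for Ĉ and D̂
  -- alike.
  obtain ⟨B, hB₁, hB₂⟩ : ∃ B, M₁ * (p : ℝ) ^ (3 / 2 : ℝ) ≤ B ∧ M₂ * (p : ℝ) ≤ B :=
    ⟨_, le_max_left _ _, le_max_right _ _⟩
  have hB0 : 0 < B := (mul_pos hM₂ hp).trans_le hB₂
  obtain ⟨m, hm, hrate⟩ := FAR.exists_eventually_radius_le hFAR.order_pos hβ hpos hlt hK hKrate
    hθrate hB0
  obtain ⟨S, hS0, hS⟩ : ∃ S : ℝ, 0 ≤ S ∧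
      FAR.sobolevSum (FAR.rowOp α) c d β ≤ ENNReal.ofReal S :=
    ⟨_, ENNReal.toReal_nonneg, (ENNReal.ofReal_toReal hSob.ne).ge⟩
  refine ⟨√(12 * m ^ 2 + 12 * m ^ 2 * ‖FAR.rowOp α‖ ^ 2 + 12 * m ^ 2 * S +
    8 * m ^ 2 * ‖FAR.rowOp α‖ ^ 2 + 2 * S), Real.sqrt_pos.2 (by positivity), ?_⟩
  -- For N ≥ p the normalizing factor of Ĉ is positive, which makes Ĉ a nonnegative operator.
  filter_upwards [hrate, eventually_ge_atTop p] with N hN hpN ω hω1 hω2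
  obtain ⟨hK1, hg, h1, h2, h3, h4, h5⟩ := hN
  have hr : 0 ≤ (N : ℝ) ^ (-(1 / 2) : ℝ) := by positivity
  have hBr := mul_nonneg hB0.le hr
  have hC := (FAR.hsNorm_le_ofReal_iff hBr).1 (hω1.trans (ENNReal.ofReal_le_ofReal
    ((mul_assoc _ _ _).symm.trans_le (mul_le_mul_of_nonneg_right hB₁ hr))))
  have hD := (FAR.hsNorm_le_ofReal_iff hBr).1 (hω2.trans (ENNReal.ofReal_le_ofReal
    ((mul_assoc _ _ _).symm.trans_le (mul_le_mul_of_nonneg_right hB₂ hr))))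
  rw [hYW] at hD
  refine le_trans ?_ (FAR.hsNorm_regularized_sub_le hc (hcHat N ω)
    (FAR.inner_empCov_nonneg X hpN ω) d hβ hS0 hS (hθpos N) hBr hC hD hK1 (hpos _) hg h1 h2 h3 h4 h5)
  exact FAR.hsNorm_component_sub_le _ α i
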